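/- A \emph{poset with inconsistent pairs} (PIP) is a finite partially ordered set $(P,\le)$ with an antireflexive, symmetric relation $\nleftrightarrow$ (inconsistency) such that $a\nleftrightarrow b$, $a\le a'$, $b\le b'$ imply $a'\nleftrightarrow b'$. A subset of $P$ is \emph{consistent} if it contains no pair $a \nleftrightarrow b$. The cubical complex $\square_P$ has as vertices the consistent downsets of $P$, and as faces the sets $C(I,M)=\{I\setminus N : N\subseteq M\}$, where $I$ is a consistent downset and $M$ is a set of maximal elements of $I$; identifying each downset with its indicator vector, its geometric realisation $\lVert\square_P\rVert\subseteq[0,1]^P$ is the union over all faces $C(I,M)$ of the convex hulls of the vectors of their vertices. The \emph{crossing complex} $\Delta_P$ is the simplicial complex with vertex set $P$ whose faces are the consistent antichains of $P$. \textbf{Proposition.} Let $P$ be a PIP. Then $\square_P$ has a cut vertex (i.e. a vertex $v$ such that $\lVert\square_P\rVert\setminus\{v\}$ is disconnected) if and only if (the geometric realisation of) $\Delta_P$ is disconnected. Here a space is called disconnected if it is the union of two disjoint non-empty open subsets; in particular the empty space is not disconnected. -/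

import Mathlib

/-- A *poset with inconsistent pairs* (PIP): a finite poset with an antireflexive, symmetric
relation that is inherited upwards. -/
class PIP (P : Type*) extends PartialOrder P where
  finite : Finite P
  /-- `Incons a b` says that `a` and `b` form an inconsistent pair. -/
  Incons : P → P → Prop
  not_incons_self : ∀ a, ¬ Incons a a
  incons_symm : ∀ {a b}, Incons a b → Incons b a
  incons_mono : ∀ {a b a' b'}, Incons a b → a ≤ a' → b ≤ b' → Incons a' b'

attribute [instance] PIP.finite

/-- A *cubical complex* on a finite vertex set `V`, with faces given by their vertex sets.
The poset of non-empty faces of the `n`-cube is the poset of non-empty intervals of the Boolean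
lattice of subsets of `Fin n`, ordered by inclusion. -/
structure CubicalComplex (V : Type*) [Finite V] where
  faces : Set (Set V)
  empty_notMem : ∅ ∉ faces
  singleton_mem : ∀ v, {v} ∈ faces
  inter_mem : ∀ σ ∈ faces, ∀ τ ∈ faces, σ ∩ τ = ∅ ∨ σ ∩ τ ∈ faces
  isCube : ∀ σ ∈ faces, ∃ n : ℕ,
    Nonempty ({τ // τ ∈ faces ∧ τ ⊆ σ} ≃o NonemptyInterval (Set (Fin n)))

namespace PIP

section

variable {P : Type*} [PIP P]

/-- A set is consistent if it contains no inconsistent pairs. -/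
def IsConsistent (S : Set P) : Prop :=
  ∀ a ∈ S, ∀ b ∈ S, ¬ Incons a b

/-- The set `max S` of maximal elements of `S`. -/
def maxElements (S : Set P) : Set P :=
  {x | Maximal (· ∈ S) x}

variable (P) in
/-- The consistent downsets of `P`, which are the vertices of the cubical complex of `P`. -/
abbrev ConsistentDownset : Type _ :=
  {I : Set P // IsLowerSet I ∧ IsConsistent I}

/-- The set of vertices `C(I, M) = {I \ N : N ⊆ M}`. -/
def cubeFace (I : ConsistentDownset P) (M : Set P) : Set (ConsistentDownset P) :=
  {J | ∃ N ⊆ M, J.1 = I.1 \ N}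

theorem mem_cubeFace {I J : ConsistentDownset P} {M : Set P} :
    J ∈ cubeFace I M ↔ I.1 \ M ⊆ J.1 ∧ J.1 ⊆ I.1 := by
  constructor
  · rintro ⟨N, hN, hJ⟩
    rw [hJ]
    exact ⟨Set.sdiff_subset_sdiff_right hN, Set.sdiff_subset⟩
  · rintro ⟨h1, h2⟩
    refine ⟨I.1 \ J.1, fun x hx => ?_, ?_⟩
    · by_contra hM
      exact hx.2 (h1 ⟨hx.1, hM⟩)
    · rw [Set.sdiff_sdiff_cancel_left h2]

/-- Removing maximal elements from a consistent downset leaves a consistent downset. -/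
def removeMax (I : ConsistentDownset P) (N : Set P) (hN : N ⊆ maxElements I.1) :
    ConsistentDownset P :=
  ⟨I.1 \ N, by
    refine ⟨fun a b hba ha => ⟨I.2.1 hba ha.1, fun hb => ha.2 ?_⟩,
      fun a ha b hb => I.2.2 a ha.1 b hb.1⟩
    have : a = b := le_antisymm ((hN hb).2 ha.1 hba) hba
    exact this ▸ hb⟩

theorem cubeFace_isCube (I : ConsistentDownset P) (M : Set P) (hM : M ⊆ maxElements I.1) :
    ∃ n : ℕ, Nonempty ({τ // (∃ (J : ConsistentDownset P) (N : Set P),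
        N ⊆ maxElements J.1 ∧ τ = cubeFace J N) ∧ τ ⊆ cubeFace I M} ≃o
      NonemptyInterval (Set (Fin n))) := by
  obtain ⟨n, ⟨e⟩⟩ := Finite.exists_equiv_fin M
  have hMI : M ⊆ I.1 := fun x hx => (hM hx).1
  let pre : Set (Fin n) → Set P := fun T => {x | ∃ h : x ∈ M, e ⟨x, h⟩ ∈ T}
  have pre_sub : ∀ T, pre T ⊆ M := fun T x hx => hx.1
  have pre_le : ∀ S T, pre S ⊆ pre T ↔ S ⊆ T := by
    intro S T
    constructor
    · intro h i hi
      have : (e.symm i).1 ∈ pre S := ⟨(e.symm i).2, by simpa using hi⟩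
      simpa using (h this).2
    · rintro h x ⟨hx, hx'⟩
      exact ⟨hx, h hx'⟩
  have pre_surj : ∀ N ⊆ M, ∃ T, pre T = N := by
    intro N hN
    refine ⟨{i | (e.symm i).1 ∈ N}, ?_⟩
    ext x
    constructor
    · rintro ⟨hx, hx'⟩
      simpa using hx'
    · intro hx
      exact ⟨hN hx, by simpa using hx⟩
  let vtx : Set (Fin n) → ConsistentDownset P :=
    fun T => removeMax I (pre T) ((pre_sub T).trans hM)
  have vtx_val : ∀ T, (vtx T).1 = I.1 \ pre T := fun T => rfl
  have vtx_le : ∀ S T, (vtx S).1 ⊆ (vtx T).1 ↔ T ⊆ S := by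
    intro S T
    rw [← pre_le, vtx_val, vtx_val]
    constructor
    · intro h x hx
      by_contra hS
      exact (h ⟨hMI (pre_sub T hx), hS⟩).2 hx
    · exact fun h => Set.sdiff_subset_sdiff_right h
  have vtx_inj : Function.Injective vtx := by
    intro S T h
    exact Set.Subset.antisymm ((vtx_le T S).1 (h ▸ subset_rfl)) ((vtx_le S T).1 (h ▸ subset_rfl))
  have vtx_surj : ∀ J ∈ cubeFace I M, ∃ T, vtx T = J := by
    rintro J ⟨N, hN, hJ⟩
    obtain ⟨T, hT⟩ := pre_surj N hN
    exact ⟨T, Subtype.ext (by rw [vtx_val, hT, hJ])⟩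
  have vtx_mem : ∀ T, vtx T ∈ cubeFace I M := fun T => ⟨pre T, pre_sub T, rfl⟩
  -- every face inside `C(I, M)` is the image of an interval
  have key : ∀ (A B : Set (Fin n)) (J : ConsistentDownset P) (N : Set P), A ⊆ B →
      J = vtx A → J.1 \ N = (vtx B).1 → vtx '' Set.Icc A B = cubeFace J N := by
    intro A B J N hAB hJ hN
    ext K
    rw [mem_cubeFace, hN, hJ]
    constructor
    · rintro ⟨T, ⟨h1, h2⟩, rfl⟩
      exact ⟨(vtx_le _ _).2 h2, (vtx_le _ _).2 h1⟩
    · rintro ⟨h1, h2⟩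
      have hK : K ∈ cubeFace I M := by
        rw [mem_cubeFace]
        refine ⟨?_, h2.trans Set.sdiff_subset⟩
        exact ((mem_cubeFace.1 (vtx_mem B)).1).trans h1
      obtain ⟨T, rfl⟩ := vtx_surj K hK
      exact ⟨T, ⟨(vtx_le _ _).1 h2, (vtx_le _ _).1 h1⟩, rfl⟩
  let g : NonemptyInterval (Set (Fin n)) → {τ // (∃ (J : ConsistentDownset P) (N : Set P),
        N ⊆ maxElements J.1 ∧ τ = cubeFace J N) ∧ τ ⊆ cubeFace I M} := fun s =>
    ⟨vtx '' Set.Icc s.fst s.snd, by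
      refine ⟨⟨vtx s.fst, pre s.snd \ pre s.fst, ?_, ?_⟩, ?_⟩
      · rintro x ⟨hx, hx'⟩
        have hxM := hM (pre_sub _ hx)
        exact ⟨⟨hxM.1, hx'⟩, fun y hy hxy => hxM.2 hy.1 hxy⟩
      · refine key _ _ _ _ s.fst_le_snd rfl ?_
        have := (pre_le _ _).2 s.fst_le_snd
        ext x
        simp only [vtx_val, Set.mem_sdiff]
        constructor
        · tauto
        · rintro ⟨h1, h2⟩
          exact ⟨⟨h1, fun h => h2 (this h)⟩, fun h => h2 h.1⟩
      · rintro _ ⟨T, -, rfl⟩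
        exact vtx_mem T⟩
  have g_le : ∀ s t, g s ≤ g t ↔ s ≤ t := by
    intro s t
    change vtx '' Set.Icc s.fst s.snd ⊆ vtx '' Set.Icc t.fst t.snd ↔ _
    rw [Set.image_subset_image_iff vtx_inj, Set.Icc_subset_Icc_iff s.fst_le_snd]
    rfl
  have g_surj : Function.Surjective g := by
    rintro ⟨_, ⟨J, N, hN, rfl⟩, hsub⟩
    have hJ : J ∈ cubeFace J N := ⟨∅, Set.empty_subset _, by simp⟩
    have hJN : removeMax J N hN ∈ cubeFace J N := ⟨N, subset_rfl, rfl⟩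
    obtain ⟨A, hA⟩ := vtx_surj _ (hsub hJ)
    obtain ⟨B, hB⟩ := vtx_surj _ (hsub hJN)
    have hAB : A ⊆ B := by
      rw [← vtx_le, hA, hB]
      exact Set.sdiff_subset
    refine ⟨⟨(A, B), hAB⟩, Subtype.ext ?_⟩
    exact key A B J N hAB hA.symm (by rw [hB]; rfl)
  exact ⟨n, ⟨(RelIso.ofSurjective (OrderEmbedding.ofMapLEIff g g_le) g_surj).symm⟩⟩

variable (P) in
/-- The cubical complex `□_P`: its vertices are the consistent downsets of `P`, and its faces are
the sets `C(I, M)` with `I` a consistent downset and `M ⊆ max I`. -/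
def box : CubicalComplex (ConsistentDownset P) where
  faces := {σ | ∃ (I : ConsistentDownset P) (M : Set P), M ⊆ maxElements I.1 ∧ σ = cubeFace I M}
  empty_notMem := by
    rintro ⟨I, M, -, h⟩
    have hI : I ∈ cubeFace I M := ⟨∅, Set.empty_subset _, by simp⟩
    rw [← h] at hI
    exact hI
  singleton_mem I := by
    refine ⟨I, ∅, Set.empty_subset _, ?_⟩
    ext J
    rw [mem_cubeFace, Set.sdiff_empty, Set.mem_singleton_iff]
    exact ⟨fun h => h ▸ ⟨subset_rfl, subset_rfl⟩, fun h => Subtype.ext (h.2.antisymm h.1)⟩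
  inter_mem := by
    rintro _ ⟨I, M, hM, rfl⟩ _ ⟨J, N, hN, rfl⟩
    refine (Set.eq_empty_or_nonempty _).imp id ?_
    rintro ⟨K, hK1, hK2⟩
    rw [mem_cubeFace] at hK1 hK2
    refine ⟨⟨I.1 ∩ J.1, I.2.1.inter J.2.1, fun a ha b hb => I.2.2 a ha.1 b hb.1⟩, M ∩ N, ?_, ?_⟩
    · rintro x ⟨hx, hx'⟩
      exact ⟨⟨(hM hx).1, (hN hx').1⟩, fun y hy hxy => (hM hx).2 hy.1 hxy⟩
    · ext L
      simp only [Set.mem_inter_iff, mem_cubeFace]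
      constructor
      · rintro ⟨⟨h1, h2⟩, h3, h4⟩
        refine ⟨?_, Set.subset_inter h2 h4⟩
        rintro x ⟨hx, hx'⟩
        by_cases hxM : x ∈ M
        · exact h3 ⟨hx.2, fun h => hx' ⟨hxM, h⟩⟩
        · exact h1 ⟨hx.1, hxM⟩
      · rintro ⟨h1, h2⟩
        refine ⟨⟨fun x hx => h1 ⟨⟨hx.1, hK2.2 (hK1.1 hx)⟩, fun h => hx.2 h.1⟩,
          fun x hx => (h2 hx).1⟩, ⟨fun x hx => h1 ⟨⟨hK1.2 (hK2.1 hx), hx.1⟩, fun h => hx.2 h.2⟩,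
          fun x hx => (h2 hx).2⟩⟩
  isCube := by
    rintro _ ⟨I, M, hM, rfl⟩
    exact cubeFace_isCube I M hM

/-- The vertex of the cube `[0,1]^P` that corresponds to a vertex of `□_P`: the indicator
function of the downset. -/
noncomputable def vertexPoint (I : ConsistentDownset P) : P → ℝ :=
  Set.indicator I.1 1

variable (P) in
/-- The geometric realisation of `□_P`, as a union of faces of the cube `[0,1]^P`. -/
def boxRealisation : Set (P → ℝ) :=
  ⋃ σ ∈ (box P).faces, convexHull ℝ (vertexPoint '' σ)

/-- A vertex of `□_P` is a *cut vertex* if removing it disconnects the geometric realisation. -/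
def IsCutVertex (v : ConsistentDownset P) : Prop :=
  ¬ IsPreconnected (boxRealisation P \ {vertexPoint v})

variable (P) in
/-- The *crossing complex* `Δ_P`: its faces are the consistent antichains of `P` (the empty face
is left out, which does not change the realisation). -/
def crossingComplex : AbstractSimplicialComplex P where
  faces := {A | A.Nonempty ∧ IsConsistent (A : Set P) ∧ IsAntichain (· ≤ ·) (A : Set P)}
  isRelLowerSet_faces := by
    rintro A ⟨hne, hc, ha⟩
    refine ⟨hne, fun B hBA hB => ⟨hB, ?_, ha.subset (Finset.coe_subset.2 hBA)⟩⟩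
    exact fun a haB b hbB => hc a (hBA haB) b (hBA hbB)
  singleton_mem v := by
    refine ⟨Finset.singleton_nonempty v, ?_, by simp⟩
    intro a ha b hb
    simp only [Finset.coe_singleton, Set.mem_singleton_iff] at ha hb
    subst ha hb
    exact not_incons_self _

end

end PIP

open Classical in
/-- The geometric realisation of a simplicial complex on a finite vertex set `V`: the union over
all faces of the convex hulls of the corresponding standard basis vectors of `ℝ^V`. -/
noncomputable def AbstractSimplicialComplex.realisation {V : Type*} [Finite V]
    (K : AbstractSimplicialComplex V) : Set (V → ℝ) :=
  ⋃ σ ∈ K.faces, convexHull ℝ ((fun v => Pi.single v (1 : ℝ)) '' (σ : Set V))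

/-!
A vertex `v` and an element `m` of the poset span an edge of `□_P` when `m` can be added to or removed
from `v`; two edges at `v` span a square exactly when their elements *cross*, that is, are consistent
and incomparable. Crossing pairs are the edges of the crossing complex, so both sides of the
equivalence can be read as statements about colourings with two colours.

The topological part is `not_isPreconnected_iUnion_iff`: a finite union of relatively closed connected
cells, any two of which meet only if they share a vertex, is disconnected if and only if its vertices
have a non-trivial colouring with two colours for which each cell is monochromatic. It is applied to the simplices of the crossing complex, and to the
cubes of `□_P` with the point `v` removed. These are still convex, because `v` is an extreme point of
`[0,1]^P`, and two of them meet only if they share a vertex other than `v`, because the coordinates of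
a common point can be rounded (`exists_mem_inter_of_mem_convexHull`).

* Suppose that `v` is a cut vertex, and colour the other vertices accordingly. Each edge, apart from
  `v`, gets a colour. Opposite edges of a square have equal colours, and all edges that belong to the
  same element `p` are connected through squares, so this colours the elements of `P`
  (`cubeFace_singleton_diff_subset_iff_principal`). Crossing elements span a square, so they have
  equal colours. Both colours occur, because every vertex lies on an edge.
* Conversely, suppose that no element of `A` crosses an element outside of `A`, and that both sets are
  non-empty. Some vertex `v` has edges of both kinds (`exists_isDirection_mem_notMem`). For another
  vertex `u`, the directions at `v` that lead towards `u` exist and cross each other, so they are all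
  of one kind, and this gives the colouring that shows `v` to be a cut vertex
  (`isCutVertex_of_isDirection`).
-/

/-! ### Connectedness of a union of cells -/

/-- Let a space be a finite union of relatively closed connected cells `C i`, and suppose that the
incidences of the cells are recorded by vertex sets `F i`: two cells meet if and only if they share
a vertex. Then the space is disconnected if and only if there is a non-trivial colouring of the
vertices with two colours for which each cell is monochromatic. -/
theorem not_isPreconnected_iUnion_iff {E ι V : Type*} [TopologicalSpace E] [Finite ι]
    {C : ι → Set E} {F : ι → Set V} (hF : ∀ i, (F i).Nonempty) (hC : ∀ i, IsPreconnected (C i))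
    (hcl : ∀ i, ∃ K, IsClosed K ∧ C i = K ∩ ⋃ j, C j)
    (hint : ∀ i j, (C i ∩ C j).Nonempty ↔ (F i ∩ F j).Nonempty) :
    ¬ IsPreconnected (⋃ i, C i) ↔ ∃ A : Set V,
      (∀ i, F i ⊆ A ∨ Disjoint (F i) A) ∧ (∃ i, F i ⊆ A) ∧ ∃ i, Disjoint (F i) A := by
  have hCne : ∀ i, (C i).Nonempty := fun i => by
    simpa using (hint i i).2 (by simpa using hF i)
  choose K hK hCK using hcl
  constructor
  · contrapose!
    intro h
    refine IsPreconnected.iUnion_of_reflTransGen hC fun i j => ?_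
    -- the vertices of the cells that can be reached from `C i` have one colour
    let R := Relation.ReflTransGen (fun k l => (C k ∩ C l).Nonempty)
    let A : Set V := ⋃ k ∈ {k | R i k}, F k
    have hA : ∀ k, R i k → F k ⊆ A := fun k hk => Set.subset_biUnion_of_mem (u := F) hk
    have hA' : ∀ k, ¬ Disjoint (F k) A → R i k := by
      intro k hk
      obtain ⟨x, hxk, hx⟩ := Set.not_disjoint_iff.1 hk
      obtain ⟨l, hl, hxl⟩ := Set.mem_iUnion₂.1 hx
      exact Relation.ReflTransGen.tail hl ((hint l k).2 ⟨x, hxl, hxk⟩)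
    refine hA' j (h A (fun k => ?_) ⟨i, hA i .refl⟩ j)
    by_cases hk : Disjoint (F k) A
    · exact .inr hk
    · exact .inl (hA k (hA' k hk))
  · rintro ⟨A, hA, ⟨i, hi⟩, ⟨j, hj⟩⟩ hpre
    rw [isPreconnected_closed_iff] at hpre
    obtain ⟨x, hx, hx1, hx2⟩ := hpre (⋃ k ∈ {k | F k ⊆ A}, K k) (⋃ k ∈ {k | Disjoint (F k) A}, K k)
      ((Set.toFinite _).isClosed_biUnion fun k _ => hK k)
      ((Set.toFinite _).isClosed_biUnion fun k _ => hK k)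
      (by
        intro x hx
        obtain ⟨k, hk⟩ := Set.mem_iUnion.1 hx
        have hxK : x ∈ K k := by rw [hCK k] at hk; exact hk.1
        exact (hA k).imp (fun h => Set.mem_iUnion₂.2 ⟨k, h, hxK⟩)
          (fun h => Set.mem_iUnion₂.2 ⟨k, h, hxK⟩))
      (by
        obtain ⟨x, hx⟩ := hCne i
        rw [hCK i] at hx
        exact ⟨x, hx.2, Set.mem_iUnion₂.2 ⟨i, hi, hx.1⟩⟩)
      (by
        obtain ⟨x, hx⟩ := hCne j
        rw [hCK j] at hx
        exact ⟨x, hx.2, Set.mem_iUnion₂.2 ⟨j, hj, hx.1⟩⟩)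
    obtain ⟨k, hk, hxk⟩ := Set.mem_iUnion₂.1 hx1
    obtain ⟨l, hl, hxl⟩ := Set.mem_iUnion₂.1 hx2
    have hkl : (C k ∩ C l).Nonempty := ⟨x, by rw [hCK k]; exact ⟨hxk, hx⟩,
      by rw [hCK l]; exact ⟨hxl, hx⟩⟩
    obtain ⟨y, hyk, hyl⟩ := (hint k l).1 hkl
    exact Set.disjoint_left.1 hl hyl (hk hyk)

/-- A vertex of the unit cube is an extreme point, so the cube stays convex without it. -/
theorem convex_Icc_diff_singleton_indicator {P : Type*} (S : Set P) :
    Convex ℝ (Set.Icc (0 : P → ℝ) 1 \ {S.indicator 1}) := by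
  rintro x ⟨hx, hxS⟩ y ⟨hy, hyS⟩ a b ha hb hab
  refine ⟨convex_Icc 0 1 hx hy ha hb hab, fun h => ?_⟩
  rw [Set.mem_singleton_iff] at h
  have key : a = 0 ∨ x = S.indicator 1 := by
    refine or_iff_not_imp_left.2 fun ha0 => funext fun p => ?_
    have ha' : 0 < a := lt_of_le_of_ne ha (Ne.symm ha0)
    have hp := congrFun h p
    have hx0 := hx.1 p
    have hx1 := hx.2 p
    have hy0 := hy.1 p
    have hy1 := hy.2 p
    simp only [Pi.add_apply, Pi.smul_apply, smul_eq_mul, Pi.zero_apply, Pi.one_apply] at *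
    by_cases hpS : p ∈ S
    · simp only [Set.indicator_of_mem hpS, Pi.one_apply] at hp ⊢
      by_contra hne
      have : x p < 1 := lt_of_le_of_ne hx1 hne
      nlinarith
    · simp only [Set.indicator_of_notMem hpS] at hp ⊢
      by_contra hne
      have : 0 < x p := lt_of_le_of_ne hx0 (Ne.symm hne)
      nlinarith
  rcases key with rfl | hx'
  · apply hyS
    have : b = 1 := by linarith
    simpa [this] using h
  · exact hxS hx'

/-! ### Cells of a simplicial complex -/

open Classical in
/-- The realisation of a simplicial complex is disconnected if and only if its vertices have a
non-trivial colouring with two colours for which each face is monochromatic. -/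
theorem AbstractSimplicialComplex.not_isPreconnected_realisation_iff {V : Type*} [Finite V]
    (K : AbstractSimplicialComplex V) :
    ¬ IsPreconnected K.realisation ↔ ∃ A : Set V,
      (∀ σ ∈ K.faces, (σ : Set V) ⊆ A ∨ Disjoint (σ : Set V) A) ∧
        (∃ a, a ∈ A) ∧ ∃ a, a ∉ A := by
  let C : K.faces → Set (V → ℝ) := fun σ =>
    convexHull ℝ ((fun v => Pi.single v (1 : ℝ)) '' (σ.1 : Set V))
  have hne : ∀ σ : K.faces, (σ.1 : Set V).Nonempty := fun σ => (K.isRelLowerSet_faces σ.2).1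
  have hC : K.realisation = ⋃ σ, C σ := by
    rw [AbstractSimplicialComplex.realisation, Set.biUnion_eq_iUnion]
  have hsupp : ∀ σ, ∀ x ∈ C σ, ∀ v, x v ≠ 0 → v ∈ (σ.1 : Set V) := by
    intro σ x hx v hv
    by_contra hvσ
    have hconv : Convex ℝ {x : V → ℝ | x v = 0} := fun y hy z hz a b _ _ _ => by
      simp only [Set.mem_ofPred_eq] at hy hz
      simp [hy, hz]
    refine hv (convexHull_min ?_ hconv hx)
    rintro _ ⟨w, hw, rfl⟩
    have hvw : v ≠ w := fun h => hvσ (h ▸ hw)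
    exact Pi.single_eq_of_ne hvw _
  have hnonzero : ∀ σ, ∀ x ∈ C σ, ∃ v, x v ≠ 0 := by
    intro σ x hx
    by_contra! h0
    have : Fintype V := Fintype.ofFinite V
    have hconv : Convex ℝ {x : V → ℝ | ∑ v, x v = 1} := fun y hy z hz a b _ _ hab => by
      simp only [Set.mem_ofPred_eq] at hy hz
      simp [Finset.sum_add_distrib, ← Finset.mul_sum, hy, hz, hab]
    have h1 : ∑ v, x v = 1 := by
      refine convexHull_min ?_ hconv hx
      rintro _ ⟨w, hw, rfl⟩
      simp
    simp [h0] at h1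
  rw [hC, not_isPreconnected_iUnion_iff (C := C) (F := fun σ => (σ.1 : Set V)) hne
    (fun σ => (convex_convexHull ℝ _).isPreconnected)
    (fun σ => ⟨C σ, ((Set.toFinite _).image _).isClosed_convexHull ℝ,
      (Set.inter_eq_left.2 (Set.subset_iUnion C σ)).symm⟩) ?_]
  · refine exists_congr fun A => and_congr Subtype.forall (and_congr ⟨?_, ?_⟩ ⟨?_, ?_⟩)
    · rintro ⟨σ, hσ⟩
      obtain ⟨a, ha⟩ := hne σ
      exact ⟨a, hσ ha⟩
    · rintro ⟨a, ha⟩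
      exact ⟨⟨{a}, K.singleton_mem a⟩, by simpa using ha⟩
    · rintro ⟨σ, hσ⟩
      obtain ⟨a, ha⟩ := hne σ
      exact ⟨a, Set.disjoint_left.1 hσ ha⟩
    · rintro ⟨a, ha⟩
      exact ⟨⟨{a}, K.singleton_mem a⟩, by simpa using ha⟩
  · intro σ τ
    constructor
    · rintro ⟨x, hxσ, hxτ⟩
      obtain ⟨v, hv⟩ := hnonzero σ x hxσ
      exact ⟨v, hsupp σ x hxσ v hv, hsupp τ x hxτ v hv⟩
    · rintro ⟨v, hvσ, hvτ⟩
      exact ⟨Pi.single v 1, subset_convexHull ℝ _ ⟨v, hvσ, rfl⟩,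
        subset_convexHull ℝ _ ⟨v, hvτ, rfl⟩⟩

namespace PIP

variable {P : Type*} [PIP P]

/-- Two elements *cross* if they are consistent and incomparable: these are the edges of the
crossing complex. -/
def Crosses (a b : P) : Prop :=
  ¬ Incons a b ∧ ¬ a ≤ b ∧ ¬ b ≤ a

theorem Crosses.symm {a b : P} (h : Crosses a b) : Crosses b a :=
  ⟨fun hi => h.1 (incons_symm hi), h.2.2, h.2.1⟩

theorem not_incons_of_le {a b : P} (h : a ≤ b) : ¬ Incons a b :=
  fun hi => not_incons_self b (incons_mono hi h le_rfl)

theorem not_isPreconnected_crossingComplex_iff :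
    ¬ IsPreconnected (crossingComplex P).realisation ↔ ∃ A : Set P,
      (∀ a b, Crosses a b → a ∈ A → b ∈ A) ∧ (∃ a, a ∈ A) ∧ ∃ a, a ∉ A := by
  classical
  rw [AbstractSimplicialComplex.not_isPreconnected_realisation_iff]
  refine exists_congr fun A => and_congr_left fun _ => ⟨fun h a b hab ha => ?_, fun h σ hσ => ?_⟩
  · have hface : ({a, b} : Finset P) ∈ (crossingComplex P).faces := by
      refine ⟨by simp, ?_, ?_⟩
      · intro x hx y hy
        simp only [Finset.coe_insert, Finset.coe_singleton, Set.mem_insert_iff,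
          Set.mem_singleton_iff] at hx hy
        rcases hx with rfl | rfl <;> rcases hy with rfl | rfl
        exacts [not_incons_self _, hab.1, hab.symm.1, not_incons_self _]
      · intro x hx y hy hxy
        simp only [Finset.coe_insert, Finset.coe_singleton, Set.mem_insert_iff,
          Set.mem_singleton_iff] at hx hy
        rcases hx with rfl | rfl <;> rcases hy with rfl | rfl
        exacts [absurd rfl hxy, hab.2.1, hab.2.2, absurd rfl hxy]
    rcases h _ hface with h | h
    · exact h (by simp)
    · exact absurd ha (Set.disjoint_left.1 h (by simp))
  · by_cases hd : Disjoint (σ : Set P) A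
    · exact .inr hd
    · obtain ⟨a, haσ, haA⟩ := Set.not_disjoint_iff.1 hd
      refine .inl fun b hb => ?_
      by_cases hab : a = b
      · exact hab ▸ haA
      · exact h a b ⟨hσ.2.1 a haσ b hb, hσ.2.2 haσ hb hab, hσ.2.2 hb haσ (Ne.symm hab)⟩ haA

/-! ### Cells of the cubical complex with a vertex removed -/

theorem vertexPoint_injective : Function.Injective (vertexPoint : ConsistentDownset P → P → ℝ) := by
  intro I J h
  refine Subtype.ext (Set.ext fun p => ?_)
  have := congrFun h p
  by_cases hI : p ∈ I.1 <;> by_cases hJ : p ∈ J.1 <;> simp_all [vertexPoint]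

theorem vertexPoint_mem_Icc (I : ConsistentDownset P) : vertexPoint I ∈ Set.Icc (0 : P → ℝ) 1 := by
  constructor <;> intro p <;> by_cases hI : p ∈ I.1 <;> simp [vertexPoint, hI]

theorem convexHull_subset_Icc (σ : Set (ConsistentDownset P)) :
    convexHull ℝ (vertexPoint '' σ) ⊆ Set.Icc (0 : P → ℝ) 1 := by
  refine convexHull_min ?_ (convex_Icc 0 1)
  rintro _ ⟨I, -, rfl⟩
  exact vertexPoint_mem_Icc I

theorem eq_zero_and_eq_one_of_mem_convexHull_cubeFace {I : ConsistentDownset P} {M : Set P}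
    {x : P → ℝ} (hx : x ∈ convexHull ℝ (vertexPoint '' cubeFace I M)) :
    (∀ p ∉ I.1, x p = 0) ∧ ∀ p ∈ I.1 \ M, x p = 1 := by
  have hconv : Convex ℝ {x : P → ℝ | (∀ p ∉ I.1, x p = 0) ∧ ∀ p ∈ I.1 \ M, x p = 1} :=
    fun y hy z hz a b _ _ hab =>
      ⟨fun p hp => by simp [hy.1 p hp, hz.1 p hp], fun p hp => by simp [hy.2 p hp, hz.2 p hp, hab]⟩
  refine convexHull_min ?_ hconv hx
  rintro _ ⟨J, hJ, rfl⟩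
  rw [mem_cubeFace] at hJ
  exact ⟨fun p hp => Set.indicator_of_notMem (fun h => hp (hJ.2 h)) _,
    fun p hp => Set.indicator_of_mem (hJ.1 hp) _⟩

/-- Let `x` be a point of two faces, other than the vertex `v`. Rounding the coordinates of `x`
strictly between `0` and `1` all up, or all down, gives two vertices of both faces, and `v` is not
both of them. -/
theorem exists_mem_inter_of_mem_convexHull {σ τ : Set (ConsistentDownset P)}
    (hσ : σ ∈ (box P).faces) (hτ : τ ∈ (box P).faces) {v : ConsistentDownset P} {x : P → ℝ}
    (hxσ : x ∈ convexHull ℝ (vertexPoint '' σ)) (hxτ : x ∈ convexHull ℝ (vertexPoint '' τ))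
    (hxv : x ≠ vertexPoint v) : ∃ u ≠ v, u ∈ σ ∩ τ := by
  obtain ⟨I, M, hM, rfl⟩ := hσ
  obtain ⟨J, N, hN, rfl⟩ := hτ
  obtain ⟨hI0, hI1⟩ := eq_zero_and_eq_one_of_mem_convexHull_cubeFace hxσ
  obtain ⟨hJ0, hJ1⟩ := eq_zero_and_eq_one_of_mem_convexHull_cubeFace hxτ
  have hMI : ∀ p ∈ I.1, x p ≠ 1 → p ∈ M := fun p hp hx => by
    by_contra h
    exact hx (hI1 p ⟨hp, h⟩)
  let S : ConsistentDownset P := removeMax I {p | p ∈ I.1 ∧ x p = 0}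
    fun p hp => hM (hMI p hp.1 (by simp [hp.2]))
  let T : ConsistentDownset P := removeMax I {p | p ∈ I.1 ∧ x p ≠ 1} fun p hp => hM (hMI p hp.1 hp.2)
  have hS : ∀ p, p ∈ S.1 ↔ x p ≠ 0 := fun p =>
    ⟨fun h h0 => h.2 ⟨h.1, h0⟩, fun h => ⟨by_contra fun hp => h (hI0 p hp), fun h' => h h'.2⟩⟩
  have hT : ∀ p, p ∈ T.1 ↔ x p = 1 := fun p =>
    ⟨fun h => by_contra fun h1 => h.2 ⟨h.1, h1⟩,
      fun h => ⟨by_contra fun hp => by simp [hI0 p hp] at h, fun h' => h'.2 h⟩⟩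
  -- the characterisations of `S` and `T` no longer mention the face that was used to define them
  have hmem : ∀ (K : ConsistentDownset P) (L : Set P), (∀ p ∉ K.1, x p = 0) →
      (∀ p ∈ K.1 \ L, x p = 1) → S ∈ cubeFace K L ∧ T ∈ cubeFace K L := by
    intro K L h0 h1
    rw [mem_cubeFace, mem_cubeFace]
    refine ⟨⟨fun p hp => (hS p).2 (by simp [h1 p hp]), fun p hp => ?_⟩,
      ⟨fun p hp => (hT p).2 (h1 p hp), fun p hp => ?_⟩⟩
    · exact by_contra fun h => (hS p).1 hp (h0 p h)
    · exact by_contra fun h => by simpa [h0 p h] using (hT p).1 hp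
  have hSI := hmem I M hI0 hI1
  have hSJ := hmem J N hJ0 hJ1
  by_cases hSv : S = v
  · refine ⟨T, fun hTv => hxv (funext fun p => ?_), hSI.2, hSJ.2⟩
    by_cases hp : p ∈ v.1
    · rw [vertexPoint, Set.indicator_of_mem hp]
      exact (hT p).1 (hTv ▸ hp)
    · rw [vertexPoint, Set.indicator_of_notMem hp]
      exact by_contra fun h => hp (hSv ▸ (hS p).2 h)
  · exact ⟨S, hSv, hSI.1, hSJ.1⟩

/-- A vertex `v` is a cut vertex if and only if the other vertices have a non-trivial colouring with
two colours for which each face is monochromatic, apart from `v`. -/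
theorem isCutVertex_iff {v : ConsistentDownset P} :
    IsCutVertex v ↔ ∃ W : Set (ConsistentDownset P),
      (∀ σ ∈ (box P).faces, σ \ {v} ⊆ W ∨ Disjoint (σ \ {v}) W) ∧
        (∃ u ≠ v, u ∈ W) ∧ ∃ u ≠ v, u ∉ W := by
  let ι := {σ // σ ∈ (box P).faces ∧ (σ \ {v}).Nonempty}
  let C : ι → Set (P → ℝ) := fun σ => convexHull ℝ (vertexPoint '' σ.1) \ {vertexPoint v}
  have hC : boxRealisation P \ {vertexPoint v} = ⋃ σ, C σ := by
    ext x
    simp only [boxRealisation, C, Set.mem_sdiff, Set.mem_iUnion, Set.mem_singleton_iff]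
    constructor
    · rintro ⟨⟨σ, hσ, hx⟩, hxv⟩
      obtain ⟨u, huv, hu⟩ := exists_mem_inter_of_mem_convexHull hσ hσ hx hx hxv
      exact ⟨⟨σ, hσ, u, hu.1, huv⟩, hx, hxv⟩
    · rintro ⟨σ, hx, hxv⟩
      exact ⟨⟨σ.1, σ.2.1, hx⟩, hxv⟩
  have hsingle : ∀ u ≠ v, ({u} \ {v} : Set (ConsistentDownset P)) = {u} := fun u hu => by
    rw [sdiff_eq_left]
    simpa using hu
  rw [IsCutVertex, hC, not_isPreconnected_iUnion_iff (C := C) (F := fun σ => σ.1 \ {v})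
    (fun σ => σ.2.2) ?_ ?_ ?_]
  · refine exists_congr fun W => and_congr ⟨fun h σ hσ => ?_, fun h σ => h σ.1 σ.2.1⟩
      (and_congr ⟨?_, ?_⟩ ⟨?_, ?_⟩)
    · rcases Set.eq_empty_or_nonempty (σ \ {v}) with h0 | h0
      · exact .inl (by simp [h0])
      · exact h ⟨σ, hσ, h0⟩
    · rintro ⟨⟨σ, _, u, hu⟩, hσ⟩
      exact ⟨u, hu.2, hσ hu⟩
    · rintro ⟨u, huv, hu⟩
      exact ⟨⟨{u}, (box P).singleton_mem u, by simp [hsingle u huv]⟩, by simpa [hsingle u huv]⟩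
    · rintro ⟨⟨σ, _, u, hu⟩, hσ⟩
      exact ⟨u, hu.2, Set.disjoint_left.1 hσ hu⟩
    · rintro ⟨u, huv, hu⟩
      exact ⟨⟨{u}, (box P).singleton_mem u, by simp [hsingle u huv]⟩, by simpa [hsingle u huv]⟩
  · intro σ
    have : C σ = convexHull ℝ (vertexPoint '' σ.1) ∩
        (Set.Icc (0 : P → ℝ) 1 \ {vertexPoint v}) := by
      rw [← Set.inter_sdiff_assoc, Set.inter_eq_left.2 (convexHull_subset_Icc _)]
    rw [this]
    exact ((convex_convexHull ℝ _).inter (convex_Icc_diff_singleton_indicator _)).isPreconnected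
  · intro σ
    refine ⟨_, ((Set.toFinite σ.1).image vertexPoint).isClosed_convexHull ℝ, ?_⟩
    rw [← hC]
    refine Set.Subset.antisymm (fun x hx => ⟨hx.1, ?_⟩) fun x hx => ⟨hx.1, hx.2.2⟩
    rw [hC]
    exact Set.mem_iUnion.2 ⟨σ, hx⟩
  · intro σ τ
    constructor
    · rintro ⟨x, hxσ, hxτ⟩
      obtain ⟨u, huv, hu⟩ :=
        exists_mem_inter_of_mem_convexHull σ.2.1 τ.2.1 hxσ.1 hxτ.1 hxσ.2
      exact ⟨u, ⟨hu.1, huv⟩, hu.2, huv⟩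
    · rintro ⟨u, huσ, huτ⟩
      have huv : vertexPoint u ≠ vertexPoint v := fun h => huσ.2 (vertexPoint_injective h)
      exact ⟨vertexPoint u, ⟨subset_convexHull ℝ _ ⟨u, huσ.1, rfl⟩, huv⟩,
        subset_convexHull ℝ _ ⟨u, huτ.1, rfl⟩, huv⟩

/-! ### A cut vertex disconnects the crossing complex -/

theorem mem_maxElements_of_subset {I J : ConsistentDownset P} (h : J.1 ⊆ I.1) {p : P}
    (hpI : p ∈ maxElements I.1) (hpJ : p ∈ J.1) : p ∈ maxElements J.1 :=
  ⟨hpJ, fun _ hq hpq => hpI.2 (h hq) hpq⟩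

/-- The downset generated by two consistent elements. -/
def lowerClosurePair (p q : P) (h : ¬ Incons p q) : ConsistentDownset P :=
  ⟨Set.Iic p ∪ Set.Iic q, (isLowerSet_Iic p).union (isLowerSet_Iic q), by
    have aux : ∀ a b c : P, a ≤ c → b ≤ c → ¬ Incons a b := fun a b c ha hb hi =>
      not_incons_self c (incons_mono hi ha hb)
    rintro a (ha | ha) b (hb | hb) hi
    · exact aux a b p ha hb hi
    · exact h (incons_mono hi ha hb)
    · exact h (incons_symm (incons_mono hi ha hb))
    · exact aux a b q ha hb hi⟩

/-- Every vertex lies on an edge, if there is another vertex. -/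
theorem exists_mem_cubeFace_singleton {u v : ConsistentDownset P} (huv : u ≠ v) :
    ∃ (J : ConsistentDownset P) (p : P), p ∈ maxElements J.1 ∧ u ∈ cubeFace J {p} := by
  rcases Set.eq_empty_or_nonempty u.1 with hu | hu
  · obtain ⟨x, hx⟩ : v.1.Nonempty := by
      rw [Set.nonempty_iff_ne_empty]
      exact fun hv => huv (Subtype.ext (hu.trans hv.symm))
    obtain ⟨m, -, hm⟩ := Finite.exists_le_minimal (p := fun _ : P => True) (a := x) trivial
    refine ⟨lowerClosurePair m m (not_incons_self m), m, ⟨.inl le_rfl, ?_⟩, ?_⟩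
    · rintro y (hy | hy) - <;> exact hy
    · rw [mem_cubeFace, hu]
      refine ⟨?_, Set.empty_subset _⟩
      rintro y ⟨hy | hy, hym⟩ <;> exact hym (le_antisymm hy (hm.2 trivial hy))
  · obtain ⟨x, hx⟩ := hu
    obtain ⟨m, -, hm⟩ := Finite.exists_le_maximal (p := (· ∈ u.1)) (a := x) hx
    exact ⟨u, m, hm, mem_cubeFace.2 ⟨Set.sdiff_subset, subset_rfl⟩⟩

/-- An edge of a cube has the colour of the cube. The edge is not reduced to `v`, because it has two
distinct vertices. -/
theorem cubeFace_singleton_diff_subset_iff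
    {v : ConsistentDownset P} {W : Set (ConsistentDownset P)}
    (hW : ∀ σ ∈ (box P).faces, σ \ {v} ⊆ W ∨ Disjoint (σ \ {v}) W)
    {I J : ConsistentDownset P} {M : Set P}
    (hM : M ⊆ maxElements I.1) (hJ : J ∈ cubeFace I M) {p : P} (hpM : p ∈ M) (hpJ : p ∈ J.1) :
    cubeFace J {p} \ {v} ⊆ W ↔ cubeFace I M \ {v} ⊆ W := by
  rw [mem_cubeFace] at hJ
  have hpJ' := mem_maxElements_of_subset hJ.2 (hM hpM) hpJ
  have hsub : cubeFace J {p} ⊆ cubeFace I M := by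
    intro K hK
    rw [mem_cubeFace] at hK ⊢
    exact ⟨fun x hx => hK.1 ⟨hJ.1 hx, fun h => hx.2 (Set.mem_singleton_iff.1 h ▸ hpM)⟩,
      hK.2.trans hJ.2⟩
  have hne : (cubeFace J {p} \ {v}).Nonempty := by
    let J' := removeMax J {p} (by simpa using hpJ')
    by_cases hJv : J = v
    · refine ⟨J', ⟨{p}, subset_rfl, rfl⟩, fun h => ?_⟩
      have hpJ2 : p ∈ J'.1 := (Set.mem_singleton_iff.1 h).trans hJv.symm ▸ hpJ
      exact hpJ2.2 rfl
    · exact ⟨J, mem_cubeFace.2 ⟨Set.sdiff_subset, subset_rfl⟩, hJv⟩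
  refine ⟨fun h => ?_, (Set.sdiff_subset_sdiff_left hsub).trans⟩
  refine (hW _ ⟨I, M, hM, rfl⟩).resolve_right fun hd => ?_
  obtain ⟨u, hu⟩ := hne
  exact Set.disjoint_left.1 hd ⟨hsub hu.1, hu.2⟩ (h hu)

/-- The colour of an edge depends only on the element `p` of the poset that its endpoints differ
by: all these edges are connected through squares to the one below the principal downset of `p`. -/
theorem cubeFace_singleton_diff_subset_iff_principal
    {v : ConsistentDownset P} {W : Set (ConsistentDownset P)}
    (hW : ∀ σ ∈ (box P).faces, σ \ {v} ⊆ W ∨ Disjoint (σ \ {v}) W)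
    {p : P} (J : ConsistentDownset P)
    (hpJ : p ∈ maxElements J.1) :
    cubeFace J {p} \ {v} ⊆ W ↔
      cubeFace (lowerClosurePair p p (not_incons_self p)) {p} \ {v} ⊆ W := by
  induction h : J.1.ncard using Nat.strong_induction_on generalizing J with
  | _ n ih =>
    by_cases hJp : J.1 ⊆ Set.Iic p
    · have : J = lowerClosurePair p p (not_incons_self p) := by
        refine Subtype.ext (Set.Subset.antisymm (fun x hx => .inl (hJp hx)) ?_)
        rintro x (hx | hx) <;> exact J.2.1 hx hpJ.1
      rw [this]
    · obtain ⟨x, hxJ, hxp⟩ := Set.not_subset.1 hJp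
      obtain ⟨q, hxq, hq⟩ := Finite.exists_le_maximal (p := (· ∈ J.1)) (a := x) hxJ
      have hqp : p ≠ q := fun e => hxp (e ▸ hxq)
      have hM : ({p, q} : Set P) ⊆ maxElements J.1 := Set.pair_subset hpJ hq
      let J' := removeMax J {q} (Set.singleton_subset_iff.2 hq)
      have hJ' : J' ∈ cubeFace J {p, q} := ⟨{q}, by simp, rfl⟩
      have hpJ' : p ∈ J'.1 := ⟨hpJ.1, hqp⟩
      rw [cubeFace_singleton_diff_subset_iff hW hM
          (mem_cubeFace.2 ⟨Set.sdiff_subset, subset_rfl⟩) (by simp) hpJ.1,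
        ← cubeFace_singleton_diff_subset_iff hW hM hJ' (by simp) hpJ']
      refine ih _ ?_ J' (mem_maxElements_of_subset (mem_cubeFace.1 hJ').2 hpJ hpJ') rfl
      rw [← h]
      exact Set.ncard_lt_ncard ⟨Set.sdiff_subset, fun hs => (hs hq.1).2 rfl⟩

theorem not_isPreconnected_crossingComplex_of_isCutVertex {v : ConsistentDownset P}
    (hv : IsCutVertex v) : ¬ IsPreconnected (crossingComplex P).realisation := by
  obtain ⟨W, hW, ⟨u, huv, huW⟩, w, hwv, hwW⟩ := isCutVertex_iff.1 hv
  refine not_isPreconnected_crossingComplex_iff.2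
    ⟨{p | cubeFace (lowerClosurePair p p (not_incons_self p)) {p} \ {v} ⊆ W},
      fun p q hpq hp => ?_, ?_, ?_⟩
  · -- crossing elements are the two directions of a square
    let I := lowerClosurePair p q hpq.1
    have hp' : p ∈ maxElements I.1 := by
      refine ⟨.inl le_rfl, ?_⟩
      rintro y (hy | hy) hpy
      exacts [hy, absurd (hpy.trans hy) hpq.2.1]
    have hq' : q ∈ maxElements I.1 := by
      refine ⟨.inr le_rfl, ?_⟩
      rintro y (hy | hy) hqy
      exacts [absurd (hqy.trans hy) hpq.2.2, hy]
    have hM : ({p, q} : Set P) ⊆ maxElements I.1 := Set.pair_subset hp' hq'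
    have hI : I ∈ cubeFace I {p, q} := mem_cubeFace.2 ⟨Set.sdiff_subset, subset_rfl⟩
    refine (cubeFace_singleton_diff_subset_iff_principal hW I hq').1 ?_
    rw [cubeFace_singleton_diff_subset_iff hW hM hI (by simp) hq'.1,
      ← cubeFace_singleton_diff_subset_iff hW hM hI (by simp) hp'.1]
    exact (cubeFace_singleton_diff_subset_iff_principal hW I hp').2 hp
  · obtain ⟨J, p, hp, hu⟩ := exists_mem_cubeFace_singleton huv
    refine ⟨p, (cubeFace_singleton_diff_subset_iff_principal hW J hp).1 ?_⟩
    refine (hW _ ⟨J, {p}, Set.singleton_subset_iff.2 hp, rfl⟩).resolve_right fun hd => ?_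
    exact Set.disjoint_left.1 hd ⟨hu, huv⟩ huW
  · obtain ⟨J, p, hp, hw⟩ := exists_mem_cubeFace_singleton hwv
    exact ⟨p, fun h =>
      hwW ((cubeFace_singleton_diff_subset_iff_principal hW J hp).2 h ⟨hw, hwv⟩)⟩

/-! ### A disconnection of the crossing complex gives a cut vertex -/

/-- The *directions* at a vertex `v` of the cubical complex: the elements that can be removed from
`v` or added to `v`. They index the edges at `v`. -/
def IsDirection (v : ConsistentDownset P) (m : P) : Prop :=
  m ∈ maxElements v.1 ∨ m ∉ v.1 ∧ (∀ q < m, q ∈ v.1) ∧ ∀ q ∈ v.1, ¬ Incons q m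

theorem IsDirection.exists_symmDiff_eq {v : ConsistentDownset P} {m : P} (hm : IsDirection v m) :
    ∃ u : ConsistentDownset P, symmDiff u.1 v.1 = {m} := by
  rcases hm with hm | ⟨hm, hlt, hc⟩
  · refine ⟨removeMax v {m} (Set.singleton_subset_iff.2 hm), ?_⟩
    ext x
    simp only [removeMax, Set.mem_symmDiff, Set.mem_sdiff, Set.mem_singleton_iff]
    have := hm.1
    grind
  · refine ⟨⟨insert m v.1, ?_, ?_⟩, ?_⟩
    · rintro a b hba (rfl | ha)
      · rcases hba.lt_or_eq with h | rfl
        exacts [.inr (hlt b h), .inl rfl]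
      · exact .inr (v.2.1 hba ha)
    · rintro a (rfl | ha) b (rfl | hb)
      exacts [not_incons_self _, fun h => hc b hb (incons_symm h), hc a ha, v.2.2 a ha b hb]
    · ext x
      simp only [Set.mem_symmDiff, Set.mem_insert_iff, Set.mem_singleton_iff]
      grind

/-- If another vertex `u` differs from `v`, then some direction at `v` leads towards `u`. -/
theorem exists_isDirection_mem_symmDiff {u v : ConsistentDownset P} (huv : u ≠ v) :
    ∃ m, IsDirection v m ∧ m ∈ symmDiff u.1 v.1 := by
  by_cases hvu : v.1 ⊆ u.1
  · have huv' : ¬ u.1 ⊆ v.1 := fun h => huv (Subtype.ext (h.antisymm hvu))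
    obtain ⟨x, hxu, hxv⟩ := Set.not_subset.1 huv'
    obtain ⟨m, -, hm⟩ :=
      Finite.exists_le_minimal (p := fun y => y ∈ u.1 ∧ y ∉ v.1) (a := x) ⟨hxu, hxv⟩
    refine ⟨m, .inr ⟨hm.1.2, fun q hq => ?_, fun q hq => u.2.2 q (hvu hq) m hm.1.1⟩, .inl hm.1⟩
    by_contra hqv
    exact hq.not_ge (hm.2 ⟨u.2.1 hq.le hm.1.1, hqv⟩ hq.le)
  · obtain ⟨x, hxv, hxu⟩ := Set.not_subset.1 hvu
    obtain ⟨m, -, hm⟩ :=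
      Finite.exists_le_maximal (p := fun y => y ∈ v.1 ∧ y ∉ u.1) (a := x) ⟨hxv, hxu⟩
    exact ⟨m, .inl ⟨hm.1.1, fun q hq hmq => hm.2 ⟨hq, fun h => hm.1.2 (u.2.1 hmq h)⟩ hmq⟩, .inr hm.1⟩

theorem crosses_of_mem_maxElements {I : ConsistentDownset P} {a b : P} (ha : a ∈ maxElements I.1)
    (hb : b ∈ maxElements I.1) (hab : a ≠ b) : Crosses a b :=
  ⟨I.2.2 a ha.1 b hb.1, fun h => hab (h.antisymm (ha.2 hb.1 h)),
    fun h => hab ((hb.2 ha.1 h).antisymm h)⟩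

/-- Distinct directions at `v` that lead towards the same vertex cross. -/
theorem IsDirection.crosses {u v : ConsistentDownset P} {a b : P} (ha : IsDirection v a)
    (hb : IsDirection v b) (hau : a ∈ symmDiff u.1 v.1) (hbu : b ∈ symmDiff u.1 v.1)
    (hab : a ≠ b) : Crosses a b := by
  have mixed : ∀ a b : P, a ∈ maxElements v.1 → b ∉ v.1 → (∀ q ∈ v.1, ¬ Incons q b) →
      a ∉ u.1 → b ∈ u.1 → Crosses a b := fun a b ha hbv hb hau hbu =>
    ⟨hb a ha.1, fun h => hau (u.2.1 h hbu), fun h => hbv (v.2.1 h ha.1)⟩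
  have mem_u : ∀ a, a ∈ symmDiff u.1 v.1 → a ∉ v.1 → a ∈ u.1 := fun a h hav =>
    h.elim (·.1) fun h => absurd h.1 hav
  have notMem_u : ∀ a, a ∈ symmDiff u.1 v.1 → a ∈ v.1 → a ∉ u.1 := fun a h hav =>
    h.elim (fun h => absurd hav h.2) (·.2)
  rcases ha with ha | ⟨ha, ha', ha''⟩ <;> rcases hb with hb | ⟨hb, hb', hb''⟩
  · exact crosses_of_mem_maxElements ha hb hab
  · exact mixed a b ha hb hb'' (notMem_u a hau ha.1) (mem_u b hbu hb)
  · exact (mixed b a hb ha ha'' (notMem_u b hbu hb.1) (mem_u a hau ha)).symm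
  · exact ⟨u.2.2 a (mem_u a hau ha) b (mem_u b hbu hb),
      fun h => ha (hb' a (lt_of_le_of_ne h hab)), fun h => hb (ha' b (lt_of_le_of_ne h hab.symm))⟩

/-- A minimal element `b` of `B` that is not minimal in the poset is a direction at the downset of
the elements below `b`, and so is any maximal element of this downset. -/
theorem exists_isDirection_of_not_isMin {B : Set P} {b : P} (hb : Minimal (· ∈ B) b)
    (hmin : ¬ IsMin b) :
    ∃ (v : ConsistentDownset P) (a : P), a ∉ B ∧ IsDirection v a ∧ IsDirection v b := by
  obtain ⟨x, hx⟩ := not_isMin_iff.1 hmin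
  let v : ConsistentDownset P := ⟨Set.Iio b, isLowerSet_Iio b, fun p hp q hq h =>
    not_incons_self b (incons_mono h (le_of_lt hp) (le_of_lt hq))⟩
  obtain ⟨a, -, ha⟩ := Finite.exists_le_maximal (p := (· ∈ v.1)) (a := x) hx
  refine ⟨v, a, fun haB => ?_, .inl ha, .inr ⟨lt_irrefl b, fun q hq => hq,
    fun q hq => not_incons_of_le (le_of_lt hq)⟩⟩
  have hab : a < b := ha.1
  exact hab.not_ge (hb.2 haB hab.le)

/-- Some vertex has a direction in a given set and another direction outside of it. -/
theorem exists_isDirection_mem_notMem {A : Set P} (hA : ∃ a, a ∈ A) (hA' : ∃ a, a ∉ A) :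
    ∃ (v : ConsistentDownset P) (a b : P),
      a ∈ A ∧ b ∉ A ∧ IsDirection v a ∧ IsDirection v b := by
  obtain ⟨x, hx⟩ := hA
  obtain ⟨y, hy⟩ := hA'
  obtain ⟨a, -, ha⟩ := Finite.exists_le_minimal (p := (· ∈ A)) (a := x) hx
  obtain ⟨b, -, hb⟩ := Finite.exists_le_minimal (p := (· ∈ Aᶜ)) (a := y) hy
  by_cases hamin : IsMin a
  · by_cases hbmin : IsMin b
    · have hdir : ∀ m : P, IsMin m → IsDirection ⟨∅, isLowerSet_empty, by simp [IsConsistent]⟩ m :=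
        fun m hm => .inr ⟨by simp, fun q hq => absurd hq hm.not_lt, by simp⟩
      exact ⟨_, a, b, ha.1, hb.1, hdir a hamin, hdir b hbmin⟩
    · obtain ⟨v, c, hc, hvc, hvb⟩ := exists_isDirection_of_not_isMin hb hbmin
      exact ⟨v, c, b, not_not.1 hc, hb.1, hvc, hvb⟩
  · obtain ⟨v, c, hc, hvc, hva⟩ := exists_isDirection_of_not_isMin ha hamin
    exact ⟨v, a, c, ha.1, hc, hva, hvc⟩

/-- If no element of `A` crosses an element outside of `A`, then a vertex with directions of both
kinds is a cut vertex: it separates the vertices according to the kind of the directions that lead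
towards them. -/
theorem isCutVertex_of_isDirection {A : Set P} (hA : ∀ a b, Crosses a b → a ∈ A → b ∈ A)
    {v : ConsistentDownset P} {a b : P} (ha : a ∈ A) (hb : b ∉ A) (hva : IsDirection v a)
    (hvb : IsDirection v b) : IsCutVertex v := by
  have ne_of_mem : ∀ (u : ConsistentDownset P) (m : P), m ∈ symmDiff u.1 v.1 → u ≠ v := by
    rintro u m hm rfl
    simp at hm
  refine isCutVertex_iff.2
    ⟨{u | ∃ m ∈ A, IsDirection v m ∧ m ∈ symmDiff u.1 v.1}, ?_, ?_, ?_⟩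
  · rintro _ ⟨I, M, hM, rfl⟩
    refine or_iff_not_imp_right.2 fun hd => ?_
    obtain ⟨u, ⟨hu, -⟩, m, hmA, hvm, hmu⟩ := Set.not_disjoint_iff.1 hd
    rintro w ⟨hw, hwv⟩
    obtain ⟨n, hvn, hnw⟩ := exists_isDirection_mem_symmDiff hwv
    -- elements that separate two vertices of the cube are among its pairwise crossing directions
    have hcube : ∀ p, ¬ (p ∈ symmDiff u.1 v.1 ↔ p ∈ symmDiff w.1 v.1) → p ∈ M := by
      intro p hp
      rw [mem_cubeFace] at hu hw
      by_contra hpM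
      have h1 : p ∈ u.1 ↔ p ∈ I.1 := ⟨fun h => hu.2 h, fun h => hu.1 ⟨h, hpM⟩⟩
      have h2 : p ∈ w.1 ↔ p ∈ I.1 := ⟨fun h => hw.2 h, fun h => hw.1 ⟨h, hpM⟩⟩
      exact hp (by rw [Set.mem_symmDiff, Set.mem_symmDiff, h1, h2])
    by_cases hmw : m ∈ symmDiff w.1 v.1
    · exact ⟨m, hmA, hvm, hmw⟩
    · refine ⟨n, ?_, hvn, hnw⟩
      by_cases hmn : m = n
      · exact hmn ▸ hmA
      · refine hA m n ?_ hmA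
        by_cases hnu : n ∈ symmDiff u.1 v.1
        · exact hvm.crosses hvn hmu hnu hmn
        · exact crosses_of_mem_maxElements (hM (hcube m fun h => hmw (h.1 hmu)))
            (hM (hcube n fun h => hnu (h.2 hnw))) hmn
  · obtain ⟨u, hu⟩ := hva.exists_symmDiff_eq
    have hau : a ∈ symmDiff u.1 v.1 := hu ▸ rfl
    exact ⟨u, ne_of_mem u a hau, a, ha, hva, hau⟩
  · obtain ⟨u, hu⟩ := hvb.exists_symmDiff_eq
    have hbu : b ∈ symmDiff u.1 v.1 := hu ▸ rfl
    refine ⟨u, ne_of_mem u b hbu, ?_⟩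
    rintro ⟨m, hmA, -, hmu⟩
    rw [hu, Set.mem_singleton_iff] at hmu
    exact hb (hmu ▸ hmA)

end PIP

theorem mainTheorem6 (P : Type*) [PIP P] :
    (∃ v : PIP.ConsistentDownset P, PIP.IsCutVertex v) ↔
      ¬ IsPreconnected (PIP.crossingComplex P).realisation := by
  refine ⟨fun ⟨v, hv⟩ => PIP.not_isPreconnected_crossingComplex_of_isCutVertex hv, fun h => ?_⟩
  obtain ⟨A, hA, hne, hne'⟩ := PIP.not_isPreconnected_crossingComplex_iff.1 h
  obtain ⟨v, a, b, ha, hb, hva, hvb⟩ := PIP.exists_isDirection_mem_notMem hne hne'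
  exact ⟨v, PIP.isCutVertex_of_isDirection hA ha hb hva hvb⟩
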